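/- For $n\ge 1$ and $0<\varepsilon<\pi/2$ put $R_n=2n\pi$ and let $\gamma_n=\gamma_n(\varepsilon)$ be the positively oriented boundary of the rectangle with vertices $-R_n,\ R_n,\ R_n+\mathrm iR_n,\ -R_n+\mathrm iR_n$, in which the segment $[-\varepsilon,\varepsilon]$ is replaced by the semicircle of radius $\varepsilon$ about $0$ in the upper half plane (so that $0$ lies outside $\gamma_n$). Put $z_k=(2k-1)\pi\mathrm i$ and let $m\ge 2$ be an integer. (a) For every $S_m\in\mathbb Q$ there are unique $w_1,\dots,w_m\in\mathbb Q$ such that for all $n\ge1$ $$\sum_{l=1}^m\int_{\gamma_n}\frac{w_l}{z(e^z+1)^l}\,\mathrm dz=\frac{2S_m}{(\mathrm i\pi)^{m-1}}\Big(\zeta(m)\big(1-2^{-m}\big)-\sum_{k=n+1}^\infty\frac1{(2k-1)^m}\Big).\qquad(*)$$ They satisfy $\sum_{l=1}^m w_l=0$ and do not depend on $n$ or $\varepsilon$. (Uniqueness holds for each fixed $\varepsilon$, even among rational $m$-tuples not assumed to have sum zero.) (b) There is a matrix $A=(b^{(l)}_j)_{1\le j,l\le m}$ with rational entries, independent of $n$,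 $\varepsilon$ and $S_m$, which is upper triangular ($b^{(l)}_j=0$ for $j>l$), has unit diagonal ($b^{(l)}_l=1$) and first row $b^{(l)}_1=1$, such that for all $n\ge1$, $0<\varepsilon<\pi/2$ and $1\le l\le m$ $$\int_{\gamma_n}\frac{\mathrm dz}{z(e^z+1)^l}=-2\pi\mathrm i\sum_{k=1}^n\sum_{j=1}^{m}\frac{b^{(l)}_j}{z_k^{\,j}},$$ and such that, for every $S_m\in\mathbb Q$, every $w\in\mathbb Q^m$ and every fixed $\varepsilon\in(0,\pi/2)$, $(*)$ holds for all $n\ge 1$ if and only if $A\,(w_1,\dots,w_m)^{T}=(0,\dots,0,-S_m)^{T}$. (c) Let $S_m=(-1)^{(m-1)/2}\,\Gamma(m)$ if $m$ is odd and $S_m=(-1)^{(m+2)/2}\,\Gamma(m)$ if $m$ is even, where $\Gamma(m)=(m-1)!$. There are unique $w_1,\dots,w_m\in\mathbb Q$ such that for all $n\ge1$ $$\sum_{l=1}^m\int_{\gamma_n}\frac{w_l}{z(e^z+1)^l}\,\mathrm dz=\frac{2\,\Gamma(m)}{\pi^{m-1}\,\mathrm i^{\kappa}}\Big(\zeta(m)\big(1-2^{-m}\big)-\sum_{k=n+1}^\infty\frac1{(2k-1)^m}\Big),$$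 with $\kappa=0$ for odd $m$ and $\kappa=1$ for even $m$; these $w_l$ do not depend on $n$ or $\varepsilon$, have sum $0$, and satisfy $(*)$ with this $S_m$. (Uniqueness holds for each fixed $\varepsilon$.) -/

import Mathlib

noncomputable section

namespace ZetaContour

/-- The integral of `f` along the oriented segment from `a` to `b`. -/
def segmentIntegral (f : ℂ → ℂ) (a b : ℂ) : ℂ :=
  ∫ t in (0 : ℝ)..1, f (a + (t : ℂ) * (b - a)) * (b - a)

/-- The integral of `f` along the semicircle `ε e^{iθ}` in the closed upper half plane, run
through clockwise (`θ` from `π` to `0`), that is from `-ε` to `ε`. -/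
def semicircleIntegral (f : ℂ → ℂ) (ε : ℝ) : ℂ :=
  ∫ θ in Real.pi..(0 : ℝ), f ((ε : ℂ) * Complex.exp ((θ : ℂ) * Complex.I)) *
    ((ε : ℂ) * Complex.I * Complex.exp ((θ : ℂ) * Complex.I))

/-- `R_n = 2nπ`. -/
def R (n : ℕ) : ℝ := 2 * (n : ℝ) * Real.pi

/-- The integral of `f` along the contour `γ_n`: the positively oriented boundary of the rectangle
with vertices `-R_n`, `R_n`, `R_n + i R_n`, `-R_n + i R_n`, where the part `[-ε, ε]` of the lower
side is replaced by the semicircle of radius `ε` in the upper half plane, so that the origin lies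
outside the contour. -/
def contourIntegral (ε : ℝ) (n : ℕ) (f : ℂ → ℂ) : ℂ :=
  segmentIntegral f (-(R n : ℂ)) (-(ε : ℂ))
    + semicircleIntegral f ε
    + segmentIntegral f (ε : ℂ) (R n : ℂ)
    + segmentIntegral f (R n : ℂ) ((R n : ℂ) + Complex.I * (R n : ℂ))
    + segmentIntegral f ((R n : ℂ) + Complex.I * (R n : ℂ)) (-(R n : ℂ) + Complex.I * (R n : ℂ))
    + segmentIntegral f (-(R n : ℂ) + Complex.I * (R n : ℂ)) (-(R n : ℂ))

/-- `z_k = (2k-1)πi`. -/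
def pole (k : ℕ) : ℂ := (2 * (k : ℂ) - 1) * (Real.pi : ℂ) * Complex.I

/-- `∑_{l=1}^m ∫_{γ_n} w_l / (z (e^z+1)^l) dz`; the coefficient `w_l` is `w i` with `l = i + 1`. -/
def weightedIntegral (m : ℕ) (w : Fin m → ℚ) (ε : ℝ) (n : ℕ) : ℂ :=
  ∑ i : Fin m, contourIntegral ε n
    (fun z => (w i : ℂ) / (z * (Complex.exp z + 1) ^ ((i : ℕ) + 1)))

/-- `ζ(m) (1 - 2^{-m}) - ∑_{k=n+1}^∞ (2k-1)^{-m}`. -/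
def zetaBracket (m n : ℕ) : ℂ :=
  riemannZeta (m : ℂ) * (1 - 1 / 2 ^ m)
    - ∑' k : ℕ, 1 / (2 * ((n + 1 + k : ℕ) : ℂ) - 1) ^ m

/-- The identity with right-hand side `2S / (iπ)^{m-1} · [ζ(m)(1-2^{-m}) - ∑_{k>n} (2k-1)^{-m}]`. -/
def IdentityS (m : ℕ) (S : ℚ) (w : Fin m → ℚ) (ε : ℝ) (n : ℕ) : Prop :=
  weightedIntegral m w ε n =
    2 * (S : ℂ) / (Complex.I * (Real.pi : ℂ)) ^ (m - 1) * zetaBracket m n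

/-- The identity with right-hand side
`2Γ(m) / (π^{m-1} i^κ) · [ζ(m)(1-2^{-m}) - ∑_{k>n} (2k-1)^{-m}]`,
where `κ = 0` for odd `m` and `κ = 1` for even `m`. -/
def IdentityGamma (m : ℕ) (w : Fin m → ℚ) (ε : ℝ) (n : ℕ) : Prop :=
  weightedIntegral m w ε n =
    2 * Complex.Gamma (m : ℂ) /
      ((Real.pi : ℂ) ^ (m - 1) * Complex.I ^ (if Even m then 1 else 0)) * zetaBracket m n

/-- `(-1)^{(m-1)/2} Γ(m)` for odd `m` and `(-1)^{(m+2)/2} Γ(m)` for even `m`,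
with `Γ(m) = (m-1)!`. -/
def specialS (m : ℕ) : ℚ :=
  (if Even m then (-1) ^ ((m + 2) / 2) else (-1) ^ ((m - 1) / 2)) * (Nat.factorial (m - 1) : ℚ)

/-- The column vector `(0, …, 0, -S)` of length `m`. -/
def rhsVector (m : ℕ) (S : ℚ) : Fin m → ℚ :=
  fun j => if (j : ℕ) + 1 = m then -S else 0

end ZetaContour

end

/-! Write `I(l, j)` for the integral of `1 / (z^j (e^z + 1)^l)` along `γ_n`. No residue at a pole of
higher order is needed. The derivative of `1 / (z^j (e^z + 1)^(l+1))`, rewritten with `e^z = (e^z +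
1) - 1`, integrates to zero over the closed contour and gives `I(l+2, j) = I(l+1, j) + j/(l+1) ·
I(l+1, j+1)` (`polarIntegral_succ`).

This reduces everything to `l = 1`, where the poles `z_k` are simple with residue `-1`. Subtracting
the principal parts leaves a function holomorphic on a convex strip (`exists_partialFraction`),
which contributes nothing. Hence `I(1, j) = -2πi ∑ z_k^(-j)` over `k ≤ n` (`polarIntegral_one`).
Unwinding the recursion gives rational coefficients forming a unit upper triangular matrix
(`polarIntegral_eq`, `expansionCoeff_self`).

The bracket in the identity is the partial sum of `(2k-1)^(-m)`, so both sides are sums over `k ≤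
n`. Equality for all `n` is equality term by term; each term is a polynomial in `1/z_k` without
constant term, and infinitely many values `1/z_k` determine its coefficients. Thus the identity is
equivalent to a triangular linear system (`identityS_iff`), which has exactly one solution. -/

namespace ZetaContour

open Complex Set Filter Topology

/-! ### The zeros of `e^z + 1` and a region avoiding them -/

/-- The part of the closed upper half plane below height `(2n+1)π` on which
`1 / (z (e^z + 1))` is regular. -/
def regularRegion (n : ℕ) : Set ℂ :=
  {z | 0 ≤ z.im ∧ z.im < (2 * n + 1) * Real.pi ∧ z ≠ 0 ∧ exp z + 1 ≠ 0}

lemma exp_add_one_eq_zero {z : ℂ} (h : exp z + 1 = 0) :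
    z.re = 0 ∧ ∃ k : ℤ, z.im = (2 * k + 1) * Real.pi := by
  have h1 : exp z = exp (Real.pi * I) := by
    rw [exp_pi_mul_I]; linear_combination h
  obtain ⟨k, rfl⟩ := exp_eq_exp_iff_exists_int.1 h1
  refine ⟨by simp, k, ?_⟩
  simp
  ring

lemma pole_eq (k : ℕ) : pole k = ((2 * k - 1) * Real.pi : ℝ) * I := by
  simp [pole]

lemma pole_re (k : ℕ) : (pole k).re = 0 := by
  rw [pole_eq]; simp

lemma pole_im (k : ℕ) : (pole k).im = (2 * k - 1) * Real.pi := by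
  rw [pole_eq, im_ofReal_mul, I_im, mul_one]


lemma mem_regularRegion_of_re_ne_zero {n : ℕ} {z : ℂ} (h0 : 0 ≤ z.im)
    (h1 : z.im ≤ R n) (hre : z.re ≠ 0) : z ∈ regularRegion n := by
  refine ⟨h0, ?_, ?_, fun h => hre (exp_add_one_eq_zero h).1⟩
  · unfold R at h1
    linarith [Real.pi_pos]
  · rintro rfl
    simp at hre

/-- The top side lies at an even multiple of `π`, the zeros of `e^z + 1` at odd multiples. -/
lemma mem_regularRegion_top {n : ℕ} (hn : 1 ≤ n) {z : ℂ} (h1 : z.im = R n) :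
    z ∈ regularRegion n := by
  have hR : 0 < R n := by
    have : (0 : ℝ) < n := by exact_mod_cast hn
    unfold R
    positivity
  refine ⟨by rw [h1]; exact hR.le, ?_, ?_, fun h => ?_⟩
  · rw [h1]
    unfold R
    linarith [Real.pi_pos]
  · rintro rfl
    simp at h1
    linarith
  · obtain ⟨k, hk⟩ := (exp_add_one_eq_zero h).2
    rw [h1, R] at hk
    have h2 : (2 * (n : ℝ)) = 2 * k + 1 := mul_right_cancel₀ Real.pi_ne_zero hk
    have h3 : 2 * (n : ℤ) = 2 * k + 1 := by exact_mod_cast h2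
    omega

lemma mem_regularRegion_low {n : ℕ} {z : ℂ} (h0 : 0 ≤ z.im) (h1 : z.im < Real.pi) (hz : z ≠ 0) :
    z ∈ regularRegion n := by
  refine ⟨h0, ?_, hz, fun h => ?_⟩
  · have : 0 ≤ (n : ℝ) * Real.pi := by positivity
    linarith
  · obtain ⟨k, hk⟩ := (exp_add_one_eq_zero h).2
    rw [hk] at h0 h1
    have h2 : (0 : ℝ) ≤ 2 * k + 1 := nonneg_of_mul_nonneg_left h0 Real.pi_pos
    have h3 : (2 * k + 1 : ℝ) < 1 := by
      by_contra! hc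
      nlinarith [Real.pi_pos]
    have h4 : (0 : ℤ) ≤ 2 * k + 1 := by exact_mod_cast h2
    have h5 : (2 * k + 1 : ℤ) < 1 := by exact_mod_cast h3
    omega

lemma R_pos {n : ℕ} (hn : 1 ≤ n) : 2 * Real.pi ≤ R n := by
  have : (1 : ℝ) ≤ n := by exact_mod_cast hn
  unfold R
  nlinarith [Real.pi_pos]


/-! ### Parametrised pieces and the fundamental theorem of calculus on each -/

/-- The point with parameter `t` on the oriented segment from `a` to `b`. -/
def segmentPoint (a b : ℂ) (t : ℝ) : ℂ := a + (t : ℂ) * (b - a)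

/-- The point `ε e^{iθ}`. -/
noncomputable def arcPoint (ε θ : ℝ) : ℂ := (ε : ℂ) * exp ((θ : ℂ) * I)

lemma hasDerivAt_segmentPoint (a b : ℂ) (t : ℝ) :
    HasDerivAt (segmentPoint a b) (b - a) t := by
  have h : HasDerivAt (fun t : ℝ => (t : ℂ)) 1 t := Complex.ofRealCLM.hasDerivAt
  have h' := (h.mul_const (b - a)).const_add a
  rwa [one_mul] at h'

lemma hasDerivAt_arcPoint (ε θ : ℝ) :
    HasDerivAt (arcPoint ε) ((ε : ℂ) * I * exp ((θ : ℂ) * I)) θ := by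
  have h : HasDerivAt (fun t : ℝ => (t : ℂ)) 1 θ := Complex.ofRealCLM.hasDerivAt
  have h' := ((h.mul_const I).cexp).const_mul (ε : ℂ)
  rwa [one_mul, mul_comm (exp _) I, ← mul_assoc] at h'

lemma intervalIntegrable_segment {f : ℂ → ℂ} {a b : ℂ}
    (hf : ∀ t ∈ Icc (0 : ℝ) 1, ContinuousAt f (segmentPoint a b t)) :
    IntervalIntegrable (fun t : ℝ => f (a + (t : ℂ) * (b - a)) * (b - a))
      MeasureTheory.volume 0 1 := by
  apply ContinuousOn.intervalIntegrable
  rw [uIcc_of_le zero_le_one]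
  intro t ht
  refine (ContinuousAt.mul ?_ continuousAt_const).continuousWithinAt
  exact (hf t ht).comp (f := segmentPoint a b) (hasDerivAt_segmentPoint a b t).continuousAt

lemma intervalIntegrable_arc {f : ℂ → ℂ} {ε : ℝ}
    (hf : ∀ θ ∈ Icc (0 : ℝ) Real.pi, ContinuousAt f (arcPoint ε θ)) :
    IntervalIntegrable (fun θ : ℝ => f ((ε : ℂ) * exp ((θ : ℂ) * I)) *
      ((ε : ℂ) * I * exp ((θ : ℂ) * I))) MeasureTheory.volume Real.pi 0 := by
  apply ContinuousOn.intervalIntegrable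
  rw [uIcc_of_ge Real.pi_pos.le]
  intro t ht
  refine (ContinuousAt.mul ?_ (by fun_prop)).continuousWithinAt
  exact (hf t ht).comp (f := arcPoint ε) (hasDerivAt_arcPoint ε t).continuousAt

lemma segmentIntegral_eq_sub {F f : ℂ → ℂ} {a b : ℂ}
    (hF : ∀ t ∈ Icc (0 : ℝ) 1, HasDerivAt F (f (segmentPoint a b t)) (segmentPoint a b t))
    (hf : ∀ t ∈ Icc (0 : ℝ) 1, ContinuousAt f (segmentPoint a b t)) :
    segmentIntegral f a b = F b - F a := by
  have h := intervalIntegral.integral_eq_sub_of_hasDerivAt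
    (f := fun t => F (segmentPoint a b t)) (fun t ht => ?_) (intervalIntegrable_segment hf)
  · rw [show F b = F (segmentPoint a b 1) by simp [segmentPoint],
      show F a = F (segmentPoint a b 0) by simp [segmentPoint]]
    exact h
  · rw [uIcc_of_le zero_le_one] at ht
    exact (hF t ht).comp_of_eq t (hasDerivAt_segmentPoint a b t) rfl

lemma semicircleIntegral_eq_sub {F f : ℂ → ℂ} {ε : ℝ}
    (hF : ∀ θ ∈ Icc (0 : ℝ) Real.pi, HasDerivAt F (f (arcPoint ε θ)) (arcPoint ε θ))
    (hf : ∀ θ ∈ Icc (0 : ℝ) Real.pi, ContinuousAt f (arcPoint ε θ)) :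
    semicircleIntegral f ε = F ε - F (-ε) := by
  have h := intervalIntegral.integral_eq_sub_of_hasDerivAt
    (f := fun t => F (arcPoint ε t)) (fun t ht => ?_) (intervalIntegrable_arc hf)
  · rw [show F ε = F (arcPoint ε 0) by simp [arcPoint],
      show F (-ε) = F (arcPoint ε Real.pi) by simp [arcPoint]]
    exact h
  · rw [uIcc_of_ge Real.pi_pos.le] at ht
    exact (hF t ht).comp_of_eq t (hasDerivAt_arcPoint ε t) rfl

/-! ### Integration along the whole contour -/

/-- A property holds at all points of the contour `γ_n(ε)`, stated piece by piece. -/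
structure OnContour (ε : ℝ) (n : ℕ) (P : ℂ → Prop) : Prop where
  bottomLeft : ∀ t ∈ Icc (0 : ℝ) 1, P (segmentPoint (-(R n : ℂ)) (-(ε : ℂ)) t)
  arc : ∀ θ ∈ Icc (0 : ℝ) Real.pi, P (arcPoint ε θ)
  bottomRight : ∀ t ∈ Icc (0 : ℝ) 1, P (segmentPoint (ε : ℂ) (R n : ℂ) t)
  right : ∀ t ∈ Icc (0 : ℝ) 1, P (segmentPoint (R n : ℂ) ((R n : ℂ) + I * (R n : ℂ)) t)
  top : ∀ t ∈ Icc (0 : ℝ) 1,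
    P (segmentPoint ((R n : ℂ) + I * (R n : ℂ)) (-(R n : ℂ) + I * (R n : ℂ)) t)
  left : ∀ t ∈ Icc (0 : ℝ) 1, P (segmentPoint (-(R n : ℂ) + I * (R n : ℂ)) (-(R n : ℂ)) t)

section Path

variable {ε : ℝ} {n : ℕ}

lemma OnContour.mono {P Q : ℂ → Prop} (h : OnContour ε n P) (hPQ : ∀ z, P z → Q z) :
    OnContour ε n Q :=
  ⟨fun t ht => hPQ _ (h.1 t ht), fun t ht => hPQ _ (h.2 t ht), fun t ht => hPQ _ (h.3 t ht),
    fun t ht => hPQ _ (h.4 t ht), fun t ht => hPQ _ (h.5 t ht), fun t ht => hPQ _ (h.6 t ht)⟩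

lemma bottomLeft_im (t : ℝ) : (segmentPoint (-(R n : ℂ)) (-(ε : ℂ)) t).im = 0 := by
  simp [segmentPoint]

lemma bottomRight_im (t : ℝ) : (segmentPoint (ε : ℂ) (R n : ℂ) t).im = 0 := by
  simp [segmentPoint]

lemma right_re (t : ℝ) :
    (segmentPoint (R n : ℂ) ((R n : ℂ) + I * (R n : ℂ)) t).re = R n := by
  simp [segmentPoint]

lemma right_im (t : ℝ) :
    (segmentPoint (R n : ℂ) ((R n : ℂ) + I * (R n : ℂ)) t).im = t * R n := by
  simp [segmentPoint]

lemma top_im (t : ℝ) :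
    (segmentPoint ((R n : ℂ) + I * (R n : ℂ)) (-(R n : ℂ) + I * (R n : ℂ)) t).im = R n := by
  simp [segmentPoint]

lemma left_re (t : ℝ) :
    (segmentPoint (-(R n : ℂ) + I * (R n : ℂ)) (-(R n : ℂ)) t).re = -R n := by
  simp [segmentPoint]

lemma left_im (t : ℝ) :
    (segmentPoint (-(R n : ℂ) + I * (R n : ℂ)) (-(R n : ℂ)) t).im = (1 - t) * R n := by
  simp [segmentPoint]
  ring

lemma arc_im (θ : ℝ) : (arcPoint ε θ).im = ε * Real.sin θ := by
  rw [arcPoint, im_ofReal_mul, exp_ofReal_mul_I_im]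

lemma onContour_regularRegion (h0 : 0 < ε) (h1 : ε < Real.pi / 2) (hn : 1 ≤ n) :
    OnContour ε n (· ∈ regularRegion n) := by
  have hR := R_pos hn
  have hpi := Real.pi_pos
  refine ⟨fun t ht => ?_, fun θ hθ => ?_, fun t ht => ?_, fun t ht => ?_, fun t ht => ?_,
    fun t ht => ?_⟩
  · refine mem_regularRegion_of_re_ne_zero (bottomLeft_im t).ge
      ((bottomLeft_im t).trans_le (by linarith)) (ne_of_lt ?_)
    have h2 := ht.1
    have h3 := ht.2
    simp [segmentPoint]
    nlinarith
  · have hs := Real.sin_nonneg_of_mem_Icc hθ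
    have hs' := Real.sin_le_one θ
    refine mem_regularRegion_low ?_ ?_ ?_
    · rw [arc_im]; positivity
    · rw [arc_im]; nlinarith
    · simp [arcPoint, h0.ne']
  · refine mem_regularRegion_of_re_ne_zero (bottomRight_im t).ge
      ((bottomRight_im t).trans_le (by linarith)) (ne_of_gt ?_)
    have h2 := ht.1
    have h3 := ht.2
    simp [segmentPoint]
    nlinarith
  · have h2 := ht.1
    have h3 := ht.2
    refine mem_regularRegion_of_re_ne_zero ?_ ?_ ?_
    · rw [right_im]; nlinarith
    · rw [right_im]; nlinarith
    · rw [right_re]; linarith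
  · exact mem_regularRegion_top hn (top_im t)
  · have h2 := ht.1
    have h3 := ht.2
    refine mem_regularRegion_of_re_ne_zero ?_ ?_ ?_
    · rw [left_im]; nlinarith
    · rw [left_im]; nlinarith
    · rw [left_re]; linarith

lemma contourIntegral_congr {f g : ℂ → ℂ} (h : OnContour ε n (fun z => f z = g z)) :
    contourIntegral ε n f = contourIntegral ε n g := by
  have hs : ∀ a b : ℂ, (∀ t ∈ Icc (0 : ℝ) 1, f (segmentPoint a b t) = g (segmentPoint a b t)) →
      segmentIntegral f a b = segmentIntegral g a b := by
    intro a b hab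
    refine intervalIntegral.integral_congr fun t ht => ?_
    rw [uIcc_of_le zero_le_one] at ht
    exact congrArg (· * (b - a)) (hab t ht)
  have ha : semicircleIntegral f ε = semicircleIntegral g ε := by
    refine intervalIntegral.integral_congr fun t ht => ?_
    rw [uIcc_of_ge Real.pi_pos.le] at ht
    exact congrArg (· * ((ε : ℂ) * I * exp ((t : ℂ) * I))) (h.arc t ht)
  simp only [contourIntegral]
  rw [hs _ _ h.1, hs _ _ h.3, hs _ _ h.4, hs _ _ h.5, hs _ _ h.6, ha]

lemma contourIntegral_const_mul (c : ℂ) (f : ℂ → ℂ) :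
    contourIntegral ε n (fun z => c * f z) = c * contourIntegral ε n f := by
  simp only [contourIntegral, segmentIntegral, semicircleIntegral, mul_assoc,
    intervalIntegral.integral_const_mul, mul_add]

lemma contourIntegral_add {f g : ℂ → ℂ} (hf : OnContour ε n (ContinuousAt f))
    (hg : OnContour ε n (ContinuousAt g)) :
    contourIntegral ε n (fun z => f z + g z) = contourIntegral ε n f + contourIntegral ε n g := by
  have hs : ∀ a b : ℂ, (∀ t ∈ Icc (0 : ℝ) 1, ContinuousAt f (segmentPoint a b t)) →
      (∀ t ∈ Icc (0 : ℝ) 1, ContinuousAt g (segmentPoint a b t)) →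
      segmentIntegral (fun z => f z + g z) a b = segmentIntegral f a b + segmentIntegral g a b := by
    intro a b h h'
    simp only [segmentIntegral, add_mul]
    exact intervalIntegral.integral_add (intervalIntegrable_segment h)
      (intervalIntegrable_segment h')
  have ha : semicircleIntegral (fun z => f z + g z) ε
      = semicircleIntegral f ε + semicircleIntegral g ε := by
    simp only [semicircleIntegral, add_mul]
    exact intervalIntegral.integral_add (intervalIntegrable_arc hf.arc)
      (intervalIntegrable_arc hg.arc)
  simp only [contourIntegral]
  rw [hs _ _ hf.1 hg.1, hs _ _ hf.3 hg.3, hs _ _ hf.4 hg.4, hs _ _ hf.5 hg.5, hs _ _ hf.6 hg.6, ha]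
  ring

lemma contourIntegral_zero : contourIntegral ε n (fun _ => 0) = 0 := by
  simp [contourIntegral, segmentIntegral, semicircleIntegral]

lemma contourIntegral_finset_sum {ι : Type*} (s : Finset ι) {f : ι → ℂ → ℂ}
    (hf : ∀ i ∈ s, OnContour ε n (ContinuousAt (f i))) :
    contourIntegral ε n (fun z => ∑ i ∈ s, f i z) = ∑ i ∈ s, contourIntegral ε n (f i) := by
  classical
  induction s using Finset.induction_on with
  | empty => simp [contourIntegral_zero]
  | insert a s ha ih =>
    have hs : ∀ i ∈ s, OnContour ε n (ContinuousAt (f i)) :=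
      fun i hi => hf i (Finset.mem_insert_of_mem hi)
    have hc : ∀ z, (∀ i ∈ s, ContinuousAt (f i) z) → ContinuousAt (fun z => ∑ i ∈ s, f i z) z :=
      fun z h => tendsto_finsetSum _ h
    simp only [Finset.sum_insert ha]
    rw [contourIntegral_add (hf a (Finset.mem_insert_self a s)), ih hs]
    exact ⟨fun t ht => hc _ fun i hi => (hs i hi).1 t ht, fun t ht => hc _ fun i hi => (hs i hi).2 t ht,
      fun t ht => hc _ fun i hi => (hs i hi).3 t ht, fun t ht => hc _ fun i hi => (hs i hi).4 t ht,
      fun t ht => hc _ fun i hi => (hs i hi).5 t ht, fun t ht => hc _ fun i hi => (hs i hi).6 t ht⟩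

lemma contourIntegral_eq_zero_of_hasDerivAt {F f : ℂ → ℂ}
    (hF : OnContour ε n (fun z => HasDerivAt F (f z) z)) (hf : OnContour ε n (ContinuousAt f)) :
    contourIntegral ε n f = 0 := by
  rw [contourIntegral, segmentIntegral_eq_sub hF.1 hf.1, semicircleIntegral_eq_sub hF.2 hf.2,
    segmentIntegral_eq_sub hF.3 hf.3, segmentIntegral_eq_sub hF.4 hf.4,
    segmentIntegral_eq_sub hF.5 hf.5, segmentIntegral_eq_sub hF.6 hf.6]
  ring

/-- The cut of `log (z - z_k)` runs horizontally to the left of `z_k` and meets the contour only on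
the left side. There `log (-(z - z_k))` serves as primitive instead; the two branches differ by `πi`
with opposite signs at the two left corners, and these jumps add up to `2πi`. -/
lemma contourIntegral_inv_sub_pole (h0 : 0 < ε) (h1 : ε < Real.pi / 2) {k : ℕ} (hk : 1 ≤ k)
    (hkn : k ≤ n) : contourIntegral ε n (fun z => 1 / (z - pole k)) = 2 * Real.pi * I := by
  have hn : 1 ≤ n := hk.trans hkn
  have hR := R_pos hn
  have hpi := Real.pi_pos
  have hk1 : (1 : ℝ) ≤ k := by exact_mod_cast hk
  have hkn1 : (k : ℝ) ≤ n := by exact_mod_cast hkn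
  have him : Real.pi ≤ (pole k).im := by rw [pole_im]; nlinarith
  have himn : (pole k).im < R n := by rw [pole_im, R]; nlinarith
  have hslit : ∀ z, z - pole k ∈ slitPlane →
      HasDerivAt (fun z => log (z - pole k)) (1 / (z - pole k)) z := fun z hz =>
    ((hasDerivAt_id z).sub_const (pole k)).clog hz
  have hslit' : ∀ z, -(z - pole k) ∈ slitPlane →
      HasDerivAt (fun z => log (-(z - pole k))) (1 / (z - pole k)) z := fun z hz => by
    have h := ((hasDerivAt_id z).sub_const (pole k)).neg.clog hz
    rw [← neg_div_neg_eq]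
    exact h
  have hne : ∀ z : ℂ, z ≠ pole k → ContinuousAt (fun z => 1 / (z - pole k)) z := fun z hz =>
    continuousAt_const.div (by fun_prop) (sub_ne_zero.2 hz)
  have hne' : ∀ z : ℂ, z - pole k ∈ slitPlane → z ≠ pole k := fun z hz =>
    sub_ne_zero.1 (slitPlane_ne_zero hz)
  have low : ∀ z : ℂ, z.im < (pole k).im → z - pole k ∈ slitPlane := fun z hz =>
    Or.inr (by rw [sub_im]; linarith)
  have c1 : ∀ t ∈ Icc (0 : ℝ) 1,
      segmentPoint (-(R n : ℂ)) (-(ε : ℂ)) t - pole k ∈ slitPlane := fun t _ =>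
    low _ (by rw [bottomLeft_im]; linarith)
  have c2 : ∀ t ∈ Icc (0 : ℝ) Real.pi, arcPoint ε t - pole k ∈ slitPlane := fun t _ =>
    low _ (by rw [arc_im]; nlinarith [Real.sin_le_one t])
  have c3 : ∀ t ∈ Icc (0 : ℝ) 1, segmentPoint (ε : ℂ) (R n : ℂ) t - pole k ∈ slitPlane :=
    fun t _ => low _ (by rw [bottomRight_im]; linarith)
  have c4 : ∀ t ∈ Icc (0 : ℝ) 1,
      segmentPoint (R n : ℂ) ((R n : ℂ) + I * (R n : ℂ)) t - pole k ∈ slitPlane :=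
    fun t _ => Or.inl (by rw [sub_re, right_re, pole_re]; linarith)
  have c5 : ∀ t ∈ Icc (0 : ℝ) 1, segmentPoint ((R n : ℂ) + I * (R n : ℂ))
      (-(R n : ℂ) + I * (R n : ℂ)) t - pole k ∈ slitPlane :=
    fun t _ => Or.inr (by rw [sub_im, top_im]; linarith)
  have c6 : ∀ t ∈ Icc (0 : ℝ) 1,
      -(segmentPoint (-(R n : ℂ) + I * (R n : ℂ)) (-(R n : ℂ)) t - pole k) ∈ slitPlane :=
    fun t _ => Or.inl (by rw [neg_re, sub_re, left_re, pole_re]; linarith)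
  have e1 : log (-(-(R n : ℂ) + I * (R n : ℂ) - pole k))
      = log (-(R n : ℂ) + I * (R n : ℂ) - pole k) - Real.pi * I := by
    rw [log, log, norm_neg, arg_neg_eq_arg_sub_pi_of_im_pos (by simp; linarith)]
    push_cast
    ring
  have e2 : log (-(-(R n : ℂ) - pole k)) = log (-(R n : ℂ) - pole k) + Real.pi * I := by
    rw [log, log, norm_neg, arg_neg_eq_arg_add_pi_of_im_neg (by simp; linarith)]
    push_cast
    ring
  rw [contourIntegral,
    segmentIntegral_eq_sub (fun t ht => hslit _ (c1 t ht)) (fun t ht => hne _ (hne' _ (c1 t ht))),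
    semicircleIntegral_eq_sub (fun t ht => hslit _ (c2 t ht))
      (fun t ht => hne _ (hne' _ (c2 t ht))),
    segmentIntegral_eq_sub (fun t ht => hslit _ (c3 t ht)) (fun t ht => hne _ (hne' _ (c3 t ht))),
    segmentIntegral_eq_sub (fun t ht => hslit _ (c4 t ht)) (fun t ht => hne _ (hne' _ (c4 t ht))),
    segmentIntegral_eq_sub (fun t ht => hslit _ (c5 t ht)) (fun t ht => hne _ (hne' _ (c5 t ht))),
    segmentIntegral_eq_sub (fun t ht => hslit' _ (c6 t ht)) (fun t ht => hne _ (fun h =>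
      slitPlane_ne_zero (c6 t ht) (by rw [h]; ring)))]
  rw [e1, e2]
  ring

end Path

/-! ### Partial fractions of `1 / (e^z + 1)` on a strip -/

/-- A holomorphic function on a convex open set has a primitive. -/
lemma exists_hasDerivAt_of_convex {V : Set ℂ} (hV : Convex ℝ V) (hVo : IsOpen V) {q : ℂ → ℂ}
    (hq : DifferentiableOn ℂ q V) : ∃ F : ℂ → ℂ, ∀ z ∈ V, HasDerivAt F (q z) z := by
  let L : ℂ →L[ℂ] ℂ →L[ℂ] ℂ := ContinuousLinearMap.mul ℂ ℂ
  -- Poincaré lemma for the form `q(z) dz`: its differential `(x, y) ↦ q'(z) x y` is symmetric, so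
  -- the form is closed.
  obtain ⟨F, hF⟩ := hV.exists_forall_hasFDerivWithinAt_of_hasFDerivWithinAt_symmetric (𝕜 := ℂ)
    (ω := fun z => L (q z))
    (dω := fun z => ((L ∘L (ContinuousLinearMap.toSpanSingleton ℂ (deriv q z)))).restrictScalars ℝ)
    (fun z hz => by
      have h := (hq.differentiableAt (hVo.mem_nhds hz)).hasDerivAt.hasFDerivAt
      have h' := L.hasFDerivAt.comp z h
      exact (h'.restrictScalars ℝ).hasFDerivWithinAt)
    (fun z _ x _ y _ => by simp [L]; ring)
  refine ⟨F, fun z hz => ?_⟩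
  have h := (hF z hz).hasFDerivAt (hVo.mem_nhds hz)
  have h' := h.hasDerivAt
  simpa [L] using h'

/-- If `f` is holomorphic on `V` off a finite set and `(z - s) f(z) → c s` at its points `s`,
then `f` minus its principal parts extends holomorphically to `V`. -/
lemma exists_differentiableOn_sub_principalParts {V : Set ℂ} (hV : IsOpen V) (c : ℂ → ℂ)
    (S : Finset ℂ) (hS : ∀ s ∈ S, s ∈ V) (f : ℂ → ℂ) (hf : DifferentiableOn ℂ f (V \ S))
    (hc : ∀ s ∈ S, Tendsto (fun z => (z - s) * f z) (𝓝[≠] s) (𝓝 (c s))) :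
    ∃ q, DifferentiableOn ℂ q V ∧ ∀ z ∈ V, z ∉ S → f z = q z + ∑ s ∈ S, c s / (z - s) := by
  classical
  induction S using Finset.induction_on generalizing f with
  | empty => exact ⟨f, by simpa using hf, by simp⟩
  | insert a S ha ih =>
    have haV : a ∈ V := hS a (Finset.mem_insert_self a S)
    -- By the removable singularity theorem `G` is holomorphic at `a`, and its divided difference at
    -- `a` is `f - c a / (z - a)` off `a`. This removes one pole and keeps the limits at the others.
    let G : ℂ → ℂ := Function.update (fun z => (z - a) * f z) a (c a)
    have hVS : IsOpen (V \ (S : Set ℂ)) := hV.sdiff S.finite_toSet.isClosed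
    have haVS : V \ (S : Set ℂ) ∈ 𝓝 a := hVS.mem_nhds ⟨haV, by simpa using ha⟩
    have hG : DifferentiableOn ℂ G (V \ (S : Set ℂ)) := by
      rw [← differentiableOn_compl_singleton_and_continuousAt_iff haVS]
      constructor
      · have h1 : DifferentiableOn ℂ (fun z => (z - a) * f z) ((V \ (S : Set ℂ)) \ {a}) := by
          refine DifferentiableOn.mul (by fun_prop) (hf.mono fun z hz => ?_)
          refine ⟨hz.1.1, ?_⟩
          simp only [Finset.coe_insert, mem_insert_iff, not_or]
          exact ⟨hz.2, hz.1.2⟩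
        exact h1.congr fun z hz => Function.update_of_ne hz.2 _ _
      · exact continuousAt_update_same.2 (hc a (Finset.mem_insert_self a S))
    have hg := (differentiableOn_dslope haVS).2 hG
    have hga : ∀ z, z ≠ a → dslope G a z = f z - c a / (z - a) := by
      intro z hz
      have hz' : z - a ≠ 0 := sub_ne_zero.2 hz
      rw [dslope_of_ne _ hz, slope_def_field]
      simp only [G, Function.update_self, Function.update_of_ne hz]
      field_simp
    obtain ⟨q, hq, hq'⟩ := ih (fun s hs => hS s (Finset.mem_insert_of_mem hs)) (dslope G a) hg
      (fun s hs => by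
        have hsa : s ≠ a := fun h => ha (h ▸ hs)
        have h1 := hc s (Finset.mem_insert_of_mem hs)
        have h2 : Tendsto (fun z => (z - s) * (c a / (z - a))) (𝓝[≠] s) (𝓝 0) := by
          have : ContinuousAt (fun z => (z - s) * (c a / (z - a))) s :=
            ContinuousAt.mul (by fun_prop)
              (continuousAt_const.div (by fun_prop) (sub_ne_zero.2 hsa))
          have h3 := this.tendsto
          simp only [sub_self, zero_mul] at h3
          exact h3.mono_left nhdsWithin_le_nhds
        have h3 := h1.sub h2
        rw [sub_zero] at h3
        refine h3.congr' ?_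
        filter_upwards [nhdsWithin_le_nhds (isOpen_ne.mem_nhds hsa)] with z hz
        rw [hga z hz]
        ring)
    refine ⟨q, hq, fun z hz hzS => ?_⟩
    rw [Finset.mem_insert, not_or] at hzS
    rw [Finset.sum_insert ha]
    have h1 := hq' z hz hzS.2
    rw [hga z hzS.1] at h1
    linear_combination h1

/-- The open strip `-π < Im z < (2n+1)π`. -/
def strip (n : ℕ) : Set ℂ := {z | -Real.pi < z.im ∧ z.im < (2 * n + 1) * Real.pi}

lemma isOpen_strip (n : ℕ) : IsOpen (strip n) :=
  (isOpen_lt continuous_const continuous_im).inter (isOpen_lt continuous_im continuous_const)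

lemma convex_strip (n : ℕ) : Convex ℝ (strip n) :=
  (convex_halfSpace_im_gt _).inter (convex_halfSpace_im_lt _)

lemma regularRegion_subset_strip {n : ℕ} {z : ℂ} (hz : z ∈ regularRegion n) : z ∈ strip n :=
  ⟨by linarith [hz.1, Real.pi_pos], hz.2.1⟩

lemma zero_mem_strip (n : ℕ) : (0 : ℂ) ∈ strip n := by
  have : 0 ≤ (n : ℝ) * Real.pi := by positivity
  refine ⟨?_, ?_⟩ <;> simp only [zero_im] <;> linarith [Real.pi_pos]

lemma pole_mem_strip {k n : ℕ} (hk : 1 ≤ k) (hkn : k ≤ n) : pole k ∈ strip n := by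
  have hk1 : (1 : ℝ) ≤ k := by exact_mod_cast hk
  have hkn1 : (k : ℝ) ≤ n := by exact_mod_cast hkn
  constructor <;> rw [pole_im] <;> nlinarith [Real.pi_pos]

lemma exp_pole (k : ℕ) : exp (pole k) = -1 := by
  rw [pole, show (2 * (k : ℂ) - 1) * Real.pi * I = (k : ℂ) * (2 * Real.pi * I) - Real.pi * I by ring,
    exp_sub, exp_nat_mul_two_pi_mul_I, exp_pi_mul_I]
  norm_num

lemma pole_ne_zero (k : ℕ) : pole k ≠ 0 := by
  intro h
  have := exp_pole k
  rw [h, exp_zero] at this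
  norm_num at this

lemma pole_injective : Function.Injective pole := by
  intro k l h
  have h1 := congrArg im h
  rw [pole_im, pole_im] at h1
  have h2 := mul_right_cancel₀ Real.pi_ne_zero h1
  have h3 : (k : ℝ) = l := by linarith
  exact_mod_cast h3

lemma eq_pole_of_mem_strip {n : ℕ} {z : ℂ} (hz : z ∈ strip n) (h : exp z + 1 = 0) :
    z ∈ (Finset.Icc 1 n).image pole := by
  obtain ⟨hre, k, hk⟩ := exp_add_one_eq_zero h
  obtain ⟨h1, h2⟩ := hz
  rw [hk] at h1 h2
  have h3 : (-1 : ℝ) < 2 * k + 1 := by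
    by_contra! hc
    nlinarith [Real.pi_pos]
  have h4 : (2 * k + 1 : ℝ) < 2 * n + 1 := lt_of_mul_lt_mul_right h2 Real.pi_pos.le
  have h5 : (-1 : ℤ) < 2 * k + 1 := by exact_mod_cast h3
  have h6 : (2 * k + 1 : ℤ) < 2 * n + 1 := by exact_mod_cast h4
  rw [Finset.mem_image]
  refine ⟨(k + 1).toNat, by rw [Finset.mem_Icc]; omega, ?_⟩
  have h7 : (((k + 1).toNat : ℕ) : ℝ) = k + 1 := by
    have : (((k + 1).toNat : ℕ) : ℤ) = k + 1 := Int.toNat_of_nonneg (by omega)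
    exact_mod_cast this
  apply Complex.ext
  · rw [pole_re, hre]
  · rw [pole_im, h7, hk]
    ring

/-- The expression is the inverse of the difference quotient of `e^z + 1` at its zero `z_k`, where
the derivative is `e^(z_k) = -1`. -/
lemma tendsto_sub_pole_div (k : ℕ) :
    Tendsto (fun z => (z - pole k) * (1 / (exp z + 1))) (𝓝[≠] (pole k)) (𝓝 (-1)) := by
  have h := (hasDerivAt_exp (pole k)).add_const 1
  rw [hasDerivAt_iff_tendsto_slope, exp_pole] at h
  have h' := h.inv₀ (by norm_num)
  rw [show (-1 : ℂ)⁻¹ = -1 by norm_num] at h'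
  refine h'.congr fun z => ?_
  rw [slope_def_field, exp_pole]
  simp [div_eq_mul_inv]

/-- The partial fraction decomposition of `1 / (e^z + 1)` on a strip. -/
lemma exists_partialFraction (n : ℕ) : ∃ q, DifferentiableOn ℂ q (strip n) ∧
    ∀ z ∈ regularRegion n,
      1 / (exp z + 1) = q z + ∑ k ∈ Finset.Icc 1 n, (-1) * (1 / (z - pole k)) := by
  classical
  obtain ⟨q, hq, hq'⟩ := exists_differentiableOn_sub_principalParts (isOpen_strip n)
    (fun _ => -1) ((Finset.Icc 1 n).image pole) (fun s hs => by
      obtain ⟨k, hk, rfl⟩ := Finset.mem_image.1 hs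
      rw [Finset.mem_Icc] at hk
      exact pole_mem_strip hk.1 hk.2) (fun z => 1 / (exp z + 1))
    (fun z hz => by
      have h1 : exp z + 1 ≠ 0 := fun h => hz.2 (by exact_mod_cast eq_pole_of_mem_strip hz.1 h)
      have h2 : DifferentiableAt ℂ (fun z => exp z + 1) z := by fun_prop
      exact ((differentiableAt_const 1).div h2 h1).differentiableWithinAt)
    (fun s hs => by
      obtain ⟨k, -, rfl⟩ := Finset.mem_image.1 hs
      exact tendsto_sub_pole_div k)
  refine ⟨q, hq, fun z hz => ?_⟩
  rw [hq' z (regularRegion_subset_strip hz) (fun h => by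
    obtain ⟨k, -, rfl⟩ := Finset.mem_image.1 h
    exact hz.2.2.2 (by rw [exp_pole]; ring)), Finset.sum_image pole_injective.injOn]
  simp [div_eq_mul_inv]


/-! ### The integrals of `1 / (z^j (e^z + 1)^l)` -/

section Contour

variable {ε : ℝ} {n : ℕ}

lemma contourIntegral_eq_zero_of_hasDerivAt_regularRegion (h0 : 0 < ε) (h1 : ε < Real.pi / 2)
    (hn : 1 ≤ n) {F f : ℂ → ℂ} (hF : ∀ z ∈ regularRegion n, HasDerivAt F (f z) z)
    (hf : ∀ z ∈ regularRegion n, ContinuousAt f z) : contourIntegral ε n f = 0 :=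
  contourIntegral_eq_zero_of_hasDerivAt ((onContour_regularRegion h0 h1 hn).mono hF)
    ((onContour_regularRegion h0 h1 hn).mono hf)

lemma contourIntegral_inv_pow (h0 : 0 < ε) (h1 : ε < Real.pi / 2) (hn : 1 ≤ n) (j : ℕ) :
    contourIntegral ε n (fun z => 1 / z ^ (j + 1)) = 0 := by
  have hcont : ∀ z ∈ regularRegion n, ContinuousAt (fun z : ℂ => 1 / z ^ (j + 1)) z :=
    fun z hz => continuousAt_const.div (by fun_prop) (pow_ne_zero _ hz.2.2.1)
  rcases j with _ | j
  -- Multiplication by `-i` turns the closed upper half plane into the closed right half plane, so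
  -- the branch cut becomes the negative imaginary axis and the contour avoids it.
  · refine contourIntegral_eq_zero_of_hasDerivAt_regularRegion h0 h1 hn
      (F := fun z => log (-I * z)) (fun z hz => ?_) hcont
    have hz0 := hz.2.2.1
    have hs : -I * z ∈ slitPlane := by
      rcases hz.1.lt_or_eq with h | h
      · exact Or.inl (by simpa using h)
      · refine Or.inr ?_
        have : z.re ≠ 0 := fun h' => hz0 (Complex.ext h' h.symm)
        simpa using this
    have h := ((hasDerivAt_id z).const_mul (-I)).clog hs
    refine h.congr_deriv ?_
    simp only [id]
    field_simp
    simp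
  · refine contourIntegral_eq_zero_of_hasDerivAt_regularRegion h0 h1 hn
      (F := fun z => (-1 / ((j : ℂ) + 1)) * (z ^ (j + 1))⁻¹) (fun z hz => ?_) hcont
    have hz0 := hz.2.2.1
    have hj : (j : ℂ) + 1 ≠ 0 := Nat.cast_add_one_ne_zero j
    have h := ((hasDerivAt_pow (j + 1) z).inv (pow_ne_zero _ hz0)).const_mul (-1 / ((j : ℂ) + 1))
    refine h.congr_deriv ?_
    simp only [Nat.add_sub_cancel]
    push_cast
    field_simp
    ring

/-- The strip contains the origin, so `q(z) = q(0) + z · dslope q 0 z` lowers the power of `z` while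
the second factor stays holomorphic on the strip. At power zero there is a primitive, the strip
being convex. -/
lemma contourIntegral_holomorphic_div_pow (h0 : 0 < ε) (h1 : ε < Real.pi / 2) (hn : 1 ≤ n)
    (j : ℕ) {q : ℂ → ℂ} (hq : DifferentiableOn ℂ q (strip n)) :
    contourIntegral ε n (fun z => q z * (1 / z ^ j)) = 0 := by
  induction j generalizing q with
  | zero =>
    obtain ⟨F, hF⟩ := exists_hasDerivAt_of_convex (convex_strip n) (isOpen_strip n) hq
    simp only [pow_zero, div_one, mul_one]
    exact contourIntegral_eq_zero_of_hasDerivAt_regularRegion h0 h1 hn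
      (fun z hz => hF z (regularRegion_subset_strip hz))
      (fun z hz => (hq.differentiableAt
        ((isOpen_strip n).mem_nhds (regularRegion_subset_strip hz))).continuousAt)
  | succ j ih =>
    have hd : DifferentiableOn ℂ (dslope q 0) (strip n) :=
      (differentiableOn_dslope ((isOpen_strip n).mem_nhds (zero_mem_strip n))).2 hq
    have hreg := onContour_regularRegion h0 h1 hn
    have hcongr : contourIntegral ε n (fun z => q z * (1 / z ^ (j + 1)))
        = contourIntegral ε n
          (fun z => q 0 * (1 / z ^ (j + 1)) + dslope q 0 z * (1 / z ^ j)) := by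
      refine contourIntegral_congr (hreg.mono fun z hz => ?_)
      have hz0 := hz.2.2.1
      rw [dslope_of_ne _ hz0, slope_def_field]
      field_simp
      ring
    have hpow : ∀ i : ℕ, ∀ z ∈ regularRegion n, ContinuousAt (fun z : ℂ => 1 / z ^ i) z :=
      fun i z hz => continuousAt_const.div (by fun_prop) (pow_ne_zero _ hz.2.2.1)
    rw [hcongr, contourIntegral_add, contourIntegral_const_mul, contourIntegral_inv_pow h0 h1 hn,
      ih hd, mul_zero, add_zero]
    · exact hreg.mono fun z hz => continuousAt_const.mul (hpow _ z hz)
    · exact hreg.mono fun z hz => (hd.differentiableAt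
        ((isOpen_strip n).mem_nhds (regularRegion_subset_strip hz))).continuousAt.mul (hpow _ z hz)

lemma ne_pole_of_mem_regularRegion {z : ℂ} (hz : z ∈ regularRegion n) (k : ℕ) :
    z - pole k ≠ 0 := by
  intro h
  refine hz.2.2.2 ?_
  rw [sub_eq_zero.1 h, exp_pole]
  ring

lemma continuousAt_inv_sub_pole_div_pow {z : ℂ} (hz : z ∈ regularRegion n) (k j : ℕ) :
    ContinuousAt (fun z => 1 / (z - pole k) * (1 / z ^ j)) z := by
  have h1 : ContinuousAt (fun z => 1 / (z - pole k)) z :=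
    continuousAt_const.div (by fun_prop) (ne_pole_of_mem_regularRegion hz k)
  have h2 : ContinuousAt (fun z : ℂ => 1 / z ^ j) z :=
    continuousAt_const.div (by fun_prop) (pow_ne_zero _ hz.2.2.1)
  exact h1.mul h2

lemma contourIntegral_inv_sub_pole_div_pow (h0 : 0 < ε) (h1 : ε < Real.pi / 2) {k : ℕ}
    (hk : 1 ≤ k) (hkn : k ≤ n) (j : ℕ) :
    contourIntegral ε n (fun z => 1 / (z - pole k) * (1 / z ^ j))
      = 2 * Real.pi * I * (1 / pole k ^ j) := by
  have hreg := onContour_regularRegion h0 h1 (hk.trans hkn)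
  have ha := pole_ne_zero k
  induction j with
  | zero =>
    simp only [pow_zero, div_one, mul_one]
    exact contourIntegral_inv_sub_pole h0 h1 hk hkn
  | succ j ih =>
    -- With `a = z_k`, the identity `a = z - (z - a)` splits the integrand; the second part is a
    -- pure power of `1/z`.
    have hcongr : contourIntegral ε n (fun z => 1 / (z - pole k) * (1 / z ^ (j + 1)))
        = contourIntegral ε n (fun z => 1 / pole k * (1 / (z - pole k) * (1 / z ^ j))
            + (-1 / pole k) * (1 / z ^ (j + 1))) := by
      refine contourIntegral_congr (hreg.mono fun z hz => ?_)
      have hz0 := hz.2.2.1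
      have hz1 := ne_pole_of_mem_regularRegion hz k
      field_simp
      ring
    rw [hcongr, contourIntegral_add, contourIntegral_const_mul, contourIntegral_const_mul, ih,
      contourIntegral_inv_pow h0 h1 (hk.trans hkn)]
    · field_simp
      ring
    · exact hreg.mono fun z hz =>
        continuousAt_const.mul (continuousAt_inv_sub_pole_div_pow hz k j)
    · exact hreg.mono fun z hz => continuousAt_const.mul
        (continuousAt_const.div (by fun_prop) (pow_ne_zero _ hz.2.2.1))

/-- The integral of `1 / (z^j (e^z + 1)^l)` along `γ_n`. -/
noncomputable def polarIntegral (ε : ℝ) (n l j : ℕ) : ℂ :=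
  contourIntegral ε n (fun z => 1 / (exp z + 1) ^ l * (1 / z ^ j))

lemma continuousAt_integrand {z : ℂ} (hz : z ∈ regularRegion n) (l j : ℕ) :
    ContinuousAt (fun z => 1 / (exp z + 1) ^ l * (1 / z ^ j)) z := by
  have h1 : ContinuousAt (fun z => 1 / (exp z + 1) ^ l) z :=
    continuousAt_const.div (by fun_prop) (pow_ne_zero _ hz.2.2.2)
  have h2 : ContinuousAt (fun z : ℂ => 1 / z ^ j) z :=
    continuousAt_const.div (by fun_prop) (pow_ne_zero _ hz.2.2.1)
  exact h1.mul h2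

lemma polarIntegral_one (h0 : 0 < ε) (h1 : ε < Real.pi / 2) (hn : 1 ≤ n) (j : ℕ) :
    polarIntegral ε n 1 j = -(2 * Real.pi * I) * ∑ k ∈ Finset.Icc 1 n, 1 / pole k ^ j := by
  obtain ⟨q, hq, hq'⟩ := exists_partialFraction n
  have hreg := onContour_regularRegion h0 h1 hn
  have hcongr : polarIntegral ε n 1 j = contourIntegral ε n (fun z => q z * (1 / z ^ j)
      + ∑ k ∈ Finset.Icc 1 n, (-1) * (1 / (z - pole k) * (1 / z ^ j))) := by
    refine contourIntegral_congr (hreg.mono fun z hz => ?_)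
    rw [pow_one, hq' z hz, add_mul, Finset.sum_mul]
    simp only [mul_assoc]
  have hc : ∀ k, ∀ z ∈ regularRegion n,
      ContinuousAt (fun z => (-1) * (1 / (z - pole k) * (1 / z ^ j))) z := fun k z hz =>
    continuousAt_const.mul (continuousAt_inv_sub_pole_div_pow hz k j)
  rw [hcongr, contourIntegral_add, contourIntegral_holomorphic_div_pow h0 h1 hn j hq,
    contourIntegral_finset_sum, zero_add, Finset.mul_sum]
  · refine Finset.sum_congr rfl fun k hk => ?_
    rw [Finset.mem_Icc] at hk
    rw [contourIntegral_const_mul, contourIntegral_inv_sub_pole_div_pow h0 h1 hk.1 hk.2]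
    ring
  · exact fun k _ => hreg.mono (hc k)
  · exact hreg.mono fun z hz => (hq.differentiableAt
      ((isOpen_strip n).mem_nhds (regularRegion_subset_strip hz))).continuousAt.mul
        (continuousAt_const.div (by fun_prop) (pow_ne_zero _ hz.2.2.1))
  · exact hreg.mono fun z hz => tendsto_finsetSum _ fun k _ => hc k z hz

/-- Integration by parts: the integrand in `hzero` is the derivative of `1 / ((l+1) z^j (e^z +
1)^(l+1))`, with `-e^z` replaced by `1 - (e^z + 1)`. -/
lemma polarIntegral_succ (h0 : 0 < ε) (h1 : ε < Real.pi / 2) (hn : 1 ≤ n) (l j : ℕ) :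
    polarIntegral ε n (l + 2) j
      = polarIntegral ε n (l + 1) j + (j : ℂ) / (l + 1) * polarIntegral ε n (l + 1) (j + 1) := by
  have hreg := onContour_regularRegion h0 h1 hn
  have hl : (l : ℂ) + 1 ≠ 0 := Nat.cast_add_one_ne_zero l
  have hc := fun (l j : ℕ) (z : ℂ) (hz : z ∈ regularRegion n) => continuousAt_integrand hz l j
  have hzero : contourIntegral ε n (fun z => 1 / (exp z + 1) ^ (l + 2) * (1 / z ^ j)
      + ((-1) * (1 / (exp z + 1) ^ (l + 1) * (1 / z ^ j))
      + (-((j : ℂ) / (l + 1))) * (1 / (exp z + 1) ^ (l + 1) * (1 / z ^ (j + 1))))) = 0 := by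
    refine contourIntegral_eq_zero_of_hasDerivAt_regularRegion h0 h1 hn
      (F := fun z => 1 / ((l : ℂ) + 1) * (((exp z + 1) ^ (l + 1))⁻¹ * (z ^ j)⁻¹))
      (fun z hz => ?_)
      (fun z hz => (hc _ _ z hz).add ((continuousAt_const.mul (hc _ _ z hz)).add
        (continuousAt_const.mul (hc _ _ z hz))))
    have hz0 := hz.2.2.1
    have hz1 := hz.2.2.2
    have hE := ((((hasDerivAt_exp z).add_const 1).fun_pow (l + 1)).fun_inv (pow_ne_zero _ hz1))
    have hP := (hasDerivAt_pow j z).fun_inv (pow_ne_zero _ hz0)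
    refine ((hE.fun_mul hP).const_mul (1 / ((l : ℂ) + 1))).congr_deriv ?_
    -- The derivative of `z^j` carries the truncated exponent `j - 1`, so `j = 0` is separate.
    rcases j with _ | j
    · simp
      field_simp
      ring
    · simp only [Nat.add_sub_cancel]
      push_cast
      field_simp
      ring
  rw [contourIntegral_add, contourIntegral_add, contourIntegral_const_mul,
    contourIntegral_const_mul] at hzero
  · simp only [polarIntegral]
    linear_combination hzero
  · exact hreg.mono fun z hz => continuousAt_const.mul (hc _ _ z hz)
  · exact hreg.mono fun z hz => continuousAt_const.mul (hc _ _ z hz)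
  · exact hreg.mono (hc _ _)
  · exact hreg.mono fun z hz => (continuousAt_const.mul (hc _ _ z hz)).add
      (continuousAt_const.mul (hc _ _ z hz))

end Contour

/-! ### The rational coefficients produced by the recursion -/

/-- The coefficients in `∫ dz / (z^j (e^z + 1)^(l+1)) = -2πi ∑_k ∑_i coeff l j i / z_k^(j+i)`. -/
def expansionCoeff : ℕ → ℕ → ℕ → ℚ
  | 0, _, 0 => 1
  | 0, _, _ + 1 => 0
  | l + 1, j, 0 => expansionCoeff l j 0
  | l + 1, j, i + 1 => expansionCoeff l j (i + 1) + (j : ℚ) / (l + 1) * expansionCoeff l (j + 1) i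

lemma expansionCoeff_zero_right (l j : ℕ) : expansionCoeff l j 0 = 1 := by
  induction l with
  | zero => rfl
  | succ l ih => rw [expansionCoeff, ih]

lemma expansionCoeff_eq_zero {l i : ℕ} (h : l < i) (j : ℕ) : expansionCoeff l j i = 0 := by
  induction l generalizing i j with
  | zero =>
    obtain ⟨i, rfl⟩ := Nat.exists_eq_succ_of_ne_zero h.ne'
    rfl
  | succ l ih =>
    obtain ⟨i, rfl⟩ := Nat.exists_eq_succ_of_ne_zero (Nat.ne_zero_of_lt h)
    rw [expansionCoeff, ih (by omega), ih (by omega)]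
    simp

/-- At the top index one of the two terms of the recursion vanishes, and the other is the quotient
rule for binomial coefficients. The recursion raises the exponent of `z`, hence the general `j`;
only `j = 0`, with value `1`, is needed for the diagonal. -/
lemma expansionCoeff_self (l j : ℕ) : expansionCoeff l (j + 1) l = ((j + l).choose l : ℕ) := by
  induction l generalizing j with
  | zero => simp [expansionCoeff]
  | succ l ih =>
    have h := Nat.choose_succ_right_eq (j + 1 + l) l
    rw [Nat.add_sub_cancel] at h
    have h' : (((j + 1 + l).choose (l + 1) : ℕ) : ℚ) * (l + 1)
        = ((j + 1 + l).choose l : ℕ) * (j + 1) := by exact_mod_cast h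
    have hl : (l : ℚ) + 1 ≠ 0 := Nat.cast_add_one_ne_zero l
    rw [expansionCoeff, expansionCoeff_eq_zero (Nat.lt_succ_self l), ih (j + 1),
      show j + (l + 1) = j + 1 + l by ring]
    push_cast
    field_simp
    linear_combination -h'

/-- Coefficients beyond index `l` vanish, so any length `m > l` is allowed. A common length turns
the coefficients for all `l` into one square matrix. -/
lemma polarIntegral_eq {ε : ℝ} {n : ℕ} (h0 : 0 < ε) (h1 : ε < Real.pi / 2) (hn : 1 ≤ n)
    {l m : ℕ} (hl : l < m) (j : ℕ) :
    polarIntegral ε n (l + 1) j = -(2 * Real.pi * I) * ∑ k ∈ Finset.Icc 1 n,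
      ∑ i ∈ Finset.range m, (expansionCoeff l j i : ℂ) / pole k ^ (j + i) := by
  obtain ⟨m, rfl⟩ := Nat.exists_eq_succ_of_ne_zero (Nat.ne_zero_of_lt hl)
  induction l generalizing m j with
  | zero =>
    rw [zero_add, polarIntegral_one h0 h1 hn]
    simp [Finset.sum_range_succ', expansionCoeff]
  | succ l ih =>
    obtain ⟨m, rfl⟩ := Nat.exists_eq_succ_of_ne_zero (n := m) (by omega)
    -- The integral with the higher power of `z` starts one power of `1/z_k` later, so its sum is
    -- taken one term shorter.
    rw [polarIntegral_succ h0 h1 hn, ih j (m + 1) (by omega), ih (j + 1) m (by omega),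
      mul_left_comm, ← mul_add]
    congr 1
    rw [Finset.mul_sum, ← Finset.sum_add_distrib]
    refine Finset.sum_congr rfl fun k _ => ?_
    rw [Finset.sum_range_succ' _ (m + 1), Finset.sum_range_succ' _ (m + 1), Finset.mul_sum,
      add_right_comm, ← Finset.sum_add_distrib]
    congr 1
    refine Finset.sum_congr rfl fun i _ => ?_
    rw [expansionCoeff, show j + 1 + i = j + (i + 1) by ring]
    push_cast
    ring

/-- The matrix `b_j^(l)`. -/
def expansionMatrix (m : ℕ) : Matrix (Fin m) (Fin m) ℚ :=
  fun j l => expansionCoeff l 1 j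

lemma contourIntegral_eq {ε : ℝ} {n m : ℕ} (h0 : 0 < ε) (h1 : ε < Real.pi / 2) (hn : 1 ≤ n)
    (l : Fin m) :
    contourIntegral ε n (fun z => 1 / (z * (exp z + 1) ^ ((l : ℕ) + 1))) =
      -(2 * (Real.pi : ℂ) * I) * ∑ k ∈ Finset.Icc 1 n, ∑ j : Fin m,
        (expansionMatrix m j l : ℂ) / pole k ^ ((j : ℕ) + 1) := by
  have h := polarIntegral_eq h0 h1 hn l.2 1
  have hfun : (fun z : ℂ => 1 / (z * (exp z + 1) ^ ((l : ℕ) + 1)))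
      = fun z => 1 / (exp z + 1) ^ ((l : ℕ) + 1) * (1 / z ^ 1) := by
    funext z
    rw [one_div_mul_one_div, pow_one, mul_comm z]
  rw [hfun]
  refine h.trans ?_
  congr 1
  refine Finset.sum_congr rfl fun k _ => ?_
  rw [Finset.sum_range]
  simp only [expansionMatrix, add_comm 1]

lemma weightedIntegral_eq {ε : ℝ} {n m : ℕ} (h0 : 0 < ε) (h1 : ε < Real.pi / 2) (hn : 1 ≤ n)
    (w : Fin m → ℚ) :
    weightedIntegral m w ε n = ∑ k ∈ Finset.Icc 1 n, -(2 * (Real.pi : ℂ) * I) * ∑ j : Fin m,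
      ((expansionMatrix m).mulVec w j : ℂ) / pole k ^ ((j : ℕ) + 1) := by
  have hterm : ∀ i : Fin m,
      contourIntegral ε n (fun z => (w i : ℂ) / (z * (exp z + 1) ^ ((i : ℕ) + 1)))
        = ∑ k ∈ Finset.Icc 1 n, -(2 * (Real.pi : ℂ) * I) * ∑ j : Fin m,
          ((expansionMatrix m j i * w i : ℚ) : ℂ) / pole k ^ ((j : ℕ) + 1) := by
    intro i
    have hfun : (fun z : ℂ => (w i : ℂ) / (z * (exp z + 1) ^ ((i : ℕ) + 1)))
        = fun z => (w i : ℂ) * (1 / (z * (exp z + 1) ^ ((i : ℕ) + 1))) := by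
      funext z
      rw [mul_one_div]
    rw [hfun, contourIntegral_const_mul, contourIntegral_eq h0 h1 hn, ← Finset.mul_sum,
      mul_left_comm, Finset.mul_sum]
    congr 1
    refine Finset.sum_congr rfl fun k _ => ?_
    rw [Finset.mul_sum]
    refine Finset.sum_congr rfl fun j _ => ?_
    push_cast
    ring
  simp only [weightedIntegral, hterm]
  rw [Finset.sum_comm]
  refine Finset.sum_congr rfl fun k _ => ?_
  rw [← Finset.mul_sum, Finset.sum_comm]
  congr 1
  refine Finset.sum_congr rfl fun j _ => ?_
  rw [← Finset.sum_div, Matrix.mulVec, dotProduct]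
  push_cast
  rfl

/-! ### The zeta bracket as a finite sum over odd numbers -/

/-- In the series for `ζ(m)` the even terms contribute `2^(-m) ζ(m)`. -/
lemma summable_one_div_odd_pow {m : ℕ} (hm : 2 ≤ m) :
    Summable (fun k : ℕ => 1 / (2 * (k : ℂ) + 1) ^ m) ∧
      ∑' k : ℕ, 1 / (2 * (k : ℂ) + 1) ^ m = riemannZeta m * (1 - 1 / 2 ^ m) := by
  let g : ℕ → ℂ := fun k => 1 / (k : ℂ) ^ m
  have hs : Summable g := by
    have h := Complex.ofRealCLM.summable
      (Real.summable_one_div_nat_pow.2 (show 1 < m by omega))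
    refine h.congr fun k => ?_
    simp [g]
  have he : Summable (fun k : ℕ => g (2 * k)) :=
    hs.comp_injective (mul_right_injective₀ two_ne_zero)
  have ho : Summable (fun k : ℕ => g (2 * k + 1)) :=
    hs.comp_injective ((add_left_injective 1).comp (mul_right_injective₀ two_ne_zero))
  have hodd : (fun k : ℕ => g (2 * k + 1)) = fun k : ℕ => 1 / (2 * (k : ℂ) + 1) ^ m := by
    funext k
    simp [g]
  have heven : ∑' k : ℕ, g (2 * k) = 1 / 2 ^ m * ∑' k : ℕ, g k := by
    rw [← tsum_mul_left]
    refine tsum_congr fun k => ?_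
    simp only [g]
    rw [Nat.cast_mul, mul_pow, one_div_mul_one_div, Nat.cast_two]
  have hsplit := tsum_even_add_odd he ho
  rw [heven, hodd] at hsplit
  refine ⟨hodd ▸ ho, ?_⟩
  rw [zeta_nat_eq_tsum_of_gt_one (by omega)]
  linear_combination hsplit

/-- The bracket is the partial sum `∑_{k=1}^n (2k-1)^{-m}`. -/
lemma zetaBracket_eq {m : ℕ} (hm : 2 ≤ m) (n : ℕ) :
    zetaBracket m n = ∑ k ∈ Finset.Icc 1 n, 1 / (2 * (k : ℂ) - 1) ^ m := by
  obtain ⟨ho, hzeta⟩ := summable_one_div_odd_pow hm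
  have hodd := ho.sum_add_tsum_nat_add n
  have htail : ∑' k : ℕ, 1 / (2 * ((n + 1 + k : ℕ) : ℂ) - 1) ^ m
      = ∑' k : ℕ, 1 / (2 * ((k + n : ℕ) : ℂ) + 1) ^ m := by
    refine tsum_congr fun k => ?_
    congr 2
    push_cast
    ring
  have hhead : ∑ k ∈ Finset.Icc 1 n, 1 / (2 * (k : ℂ) - 1) ^ m
      = ∑ k ∈ Finset.range n, 1 / (2 * (k : ℂ) + 1) ^ m := by
    clear hodd htail
    induction n with
    | zero => simp
    | succ n ih =>
      rw [Finset.sum_Icc_succ_top (by omega), ih, Finset.sum_range_succ]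
      congr 3
      push_cast
      ring
  rw [zetaBracket, htail, hhead, ← hzeta]
  linear_combination -hodd

/-! ### From the identity for all `n` to a linear system -/

lemma forall_sum_Icc_eq_iff {a b : ℕ → ℂ} :
    (∀ n, 1 ≤ n → ∑ k ∈ Finset.Icc 1 n, a k = ∑ k ∈ Finset.Icc 1 n, b k) ↔
      ∀ k, 1 ≤ k → a k = b k := by
  constructor
  · intro h k hk
    obtain ⟨k, rfl⟩ := Nat.exists_eq_succ_of_ne_zero (Nat.ne_zero_of_lt hk)
    have h1 := h (k + 1) (by omega)
    have h2 : ∑ k ∈ Finset.Icc 1 k, a k = ∑ k ∈ Finset.Icc 1 k, b k := by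
      rcases Nat.eq_zero_or_pos k with rfl | hk'
      · simp
      · exact h k hk'
    rw [Finset.sum_Icc_succ_top (by omega), Finset.sum_Icc_succ_top (by omega), h2] at h1
    exact add_left_cancel h1
  · intro h n _
    exact Finset.sum_congr rfl fun k hk => h k (Finset.mem_Icc.1 hk).1

/-- After multiplication by `z_k` the sum is the value at `1/z_k` of one fixed polynomial, which
therefore has infinitely many roots. -/
lemma eq_zero_of_forall_sum_div_pole_pow {m : ℕ} {v : Fin m → ℂ}
    (h : ∀ k, 1 ≤ k → ∑ j : Fin m, v j / pole k ^ ((j : ℕ) + 1) = 0) (j : Fin m) : v j = 0 := by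
  let p : Polynomial ℂ := ∑ j : Fin m, Polynomial.monomial (j : ℕ) (v j)
  have hroot : ∀ k, 1 ≤ k → p.IsRoot (pole k)⁻¹ := by
    intro k hk
    have hk0 := pole_ne_zero k
    have h1 : p.eval (pole k)⁻¹ = pole k * ∑ j : Fin m, v j / pole k ^ ((j : ℕ) + 1) := by
      simp only [p, Polynomial.eval_finsetSum, Polynomial.eval_monomial, Finset.mul_sum]
      refine Finset.sum_congr rfl fun j _ => ?_
      rw [pow_succ, inv_pow]
      field_simp
    rw [Polynomial.IsRoot, h1, h k hk, mul_zero]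
  have hp : p = 0 := by
    refine Polynomial.eq_zero_of_infinite_isRoot p ?_
    refine Set.infinite_of_injective_forall_mem (f := fun k : ℕ => (pole (k + 1))⁻¹)
      (fun a b hab => ?_) (fun k => hroot (k + 1) (by omega))
    have := pole_injective (inv_injective hab)
    omega
  have hcoeff : p.coeff j = v j := by
    simp only [p, Polynomial.finsetSum_coeff, Polynomial.coeff_monomial, Fin.val_inj]
    simp
  rw [← hcoeff, hp, Polynomial.coeff_zero]

/-- Only the last coordinate survives, and `-2πi · (-S) / (πi)^m = 2S / (iπ)^(m-1)`. -/
lemma rhs_eq {m : ℕ} (hm : 2 ≤ m) (S : ℚ) (k : ℕ) :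
    2 * (S : ℂ) / (I * (Real.pi : ℂ)) ^ (m - 1) * (1 / (2 * (k : ℂ) - 1) ^ m)
      = -(2 * (Real.pi : ℂ) * I) * ∑ j : Fin m,
        (rhsVector m S j : ℂ) / pole k ^ ((j : ℕ) + 1) := by
  obtain ⟨m, rfl⟩ : ∃ d, m = d + 1 := ⟨m - 1, by omega⟩
  have hsum : ∑ j : Fin (m + 1), (rhsVector (m + 1) S j : ℂ) / pole k ^ ((j : ℕ) + 1)
      = -(S : ℂ) / pole k ^ (m + 1) := by
    rw [Finset.sum_eq_single (Fin.last m)]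
    · simp [rhsVector]
    · intro j _ hj
      have : (j : ℕ) ≠ m := fun h => hj (Fin.ext h)
      simp [rhsVector, this]
    · simp
  have hodd : (2 * (k : ℂ) - 1) ≠ 0 := by
    intro h
    have h' : (2 * (k : ℤ) - 1) = 0 := by exact_mod_cast h
    omega
  have hpi : (Real.pi : ℂ) ≠ 0 := by exact_mod_cast Real.pi_ne_zero
  have hI := I_ne_zero
  rw [hsum, pole, Nat.add_sub_cancel]
  simp only [mul_pow]
  field_simp
  ring

/-- The identity with parameter `S` is equivalent to the triangular linear system. -/
lemma identityS_iff {m : ℕ} (hm : 2 ≤ m) {ε : ℝ} (h0 : 0 < ε) (h1 : ε < Real.pi / 2) (S : ℚ)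
    (w : Fin m → ℚ) :
    (∀ n : ℕ, 1 ≤ n → IdentityS m S w ε n) ↔ (expansionMatrix m).mulVec w = rhsVector m S := by
  have hid : ∀ n, 1 ≤ n → (IdentityS m S w ε n ↔
      ∑ k ∈ Finset.Icc 1 n, -(2 * (Real.pi : ℂ) * I) * ∑ j : Fin m,
        ((expansionMatrix m).mulVec w j : ℂ) / pole k ^ ((j : ℕ) + 1) =
      ∑ k ∈ Finset.Icc 1 n, -(2 * (Real.pi : ℂ) * I) * ∑ j : Fin m,
        (rhsVector m S j : ℂ) / pole k ^ ((j : ℕ) + 1)) := by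
    intro n hn
    rw [IdentityS, weightedIntegral_eq h0 h1 hn, zetaBracket_eq hm, Finset.mul_sum,
      Finset.sum_congr rfl fun k _ => rhs_eq hm S k]
  have hpi : -(2 * (Real.pi : ℂ) * I) ≠ 0 := neg_ne_zero.2 two_pi_I_ne_zero
  rw [forall₂_congr hid, forall_sum_Icc_eq_iff]
  constructor
  · intro h
    funext j
    have h2 := eq_zero_of_forall_sum_div_pole_pow
      (v := fun j => ((expansionMatrix m).mulVec w j : ℂ) - (rhsVector m S j : ℂ)) (fun k hk => by
        simp only [sub_div, Finset.sum_sub_distrib]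
        exact sub_eq_zero.2 (mul_left_cancel₀ hpi (h k hk))) j
    exact_mod_cast sub_eq_zero.1 h2
  · intro h k _
    rw [h]

/-! ### Solving the triangular system -/

lemma expansionMatrix_apply_eq_zero {m : ℕ} {j l : Fin m} (h : l < j) :
    expansionMatrix m j l = 0 := expansionCoeff_eq_zero h 1

lemma expansionMatrix_apply_self {m : ℕ} (j : Fin m) : expansionMatrix m j j = 1 := by
  have := expansionCoeff_self j 0
  rw [zero_add, zero_add, Nat.choose_self, Nat.cast_one] at this
  exact this

lemma expansionMatrix_apply_zero {m : ℕ} {j : Fin m} (h : (j : ℕ) = 0) (l : Fin m) :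
    expansionMatrix m j l = 1 := by
  rw [expansionMatrix, h, expansionCoeff_zero_right]

lemma isUnit_expansionMatrix (m : ℕ) : IsUnit (expansionMatrix m) := by
  have h : (expansionMatrix m).BlockTriangular id := fun j l h => expansionMatrix_apply_eq_zero h
  rw [Matrix.isUnit_iff_isUnit_det, Matrix.det_of_isUpperTriangular h]
  simp [expansionMatrix_apply_self]

lemma existsUnique_expansionMatrix_mulVec (m : ℕ) (v : Fin m → ℚ) :
    ∃! w, (expansionMatrix m).mulVec w = v := by
  have h := isUnit_expansionMatrix m
  refine ⟨(expansionMatrix m)⁻¹.mulVec v, ?_, fun w hw => ?_⟩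
  · change (expansionMatrix m).mulVec _ = v
    rw [Matrix.mulVec_mulVec,
      Matrix.mul_nonsing_inv _ ((Matrix.isUnit_iff_isUnit_det _).1 h), Matrix.one_mulVec]
  · rw [← hw, Matrix.mulVec_mulVec,
      Matrix.nonsing_inv_mul _ ((Matrix.isUnit_iff_isUnit_det _).1 h), Matrix.one_mulVec]

/-- The first row of the matrix consists of ones, and for `m ≥ 2` the first entry of the right-hand
side is not the last one, hence zero. -/
lemma sum_eq_zero_of_mulVec_eq {m : ℕ} (hm : 2 ≤ m) {S : ℚ} {w : Fin m → ℚ}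
    (h : (expansionMatrix m).mulVec w = rhsVector m S) : ∑ i, w i = 0 := by
  have h1 := congrFun h ⟨0, by omega⟩
  rw [Matrix.mulVec, dotProduct, rhsVector, if_neg (by simp only; omega)] at h1
  simpa only [expansionMatrix_apply_zero, one_mul] using h1

/-- `(-1)^{...} Γ(m) / i^{m-1} = Γ(m) / i^κ`. -/
lemma specialS_div {m : ℕ} (hm : 2 ≤ m) :
    2 * (specialS m : ℂ) / (I * (Real.pi : ℂ)) ^ (m - 1)
      = 2 * Gamma (m : ℂ) / ((Real.pi : ℂ) ^ (m - 1) * I ^ (if Even m then 1 else 0)) := by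
  have hG : Gamma (m : ℂ) = ((m - 1).factorial : ℂ) := by
    have := Gamma_nat_eq_factorial (m - 1)
    rwa [← Nat.cast_add_one, Nat.sub_add_cancel (by omega)] at this
  have hpi : (Real.pi : ℂ) ≠ 0 := by exact_mod_cast Real.pi_ne_zero
  have hI := I_ne_zero
  -- The sign in `specialS` is chosen so that it equals `i^(m-1) / i^κ`.
  have key : ((if Even m then (-1) ^ ((m + 2) / 2) else (-1) ^ ((m - 1) / 2) : ℚ) : ℂ)
      * I ^ (if Even m then 1 else 0) = I ^ (m - 1) := by
    rcases Nat.even_or_odd' m with ⟨r, rfl | rfl⟩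
    · obtain ⟨r, rfl⟩ : ∃ d, r = d + 1 := ⟨r - 1, by omega⟩
      rw [if_pos (even_two_mul _), if_pos (even_two_mul _),
        show (2 * (r + 1) + 2) / 2 = r + 2 by omega, show 2 * (r + 1) - 1 = 2 * r + 1 by omega,
        pow_succ I (2 * r), pow_mul, I_sq]
      push_cast
      ring
    · rw [if_neg (Nat.not_even_two_mul_add_one r), if_neg (Nat.not_even_two_mul_add_one r),
        Nat.add_sub_cancel, Nat.mul_div_cancel_left r two_pos, pow_mul, I_sq]
      push_cast
      ring
  rw [hG, mul_pow, specialS, div_eq_div_iff (by positivity) (by positivity), ← key]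
  push_cast
  ring

lemma identityS_specialS_iff {m : ℕ} (hm : 2 ≤ m) (w : Fin m → ℚ) (ε : ℝ) (n : ℕ) :
    IdentityS m (specialS m) w ε n ↔ IdentityGamma m w ε n := by
  rw [IdentityS, IdentityGamma, specialS_div hm]

end ZetaContour

theorem lemma3p1 (m : ℕ) (hm : 2 ≤ m) :
    -- for every rational `S` there are unique coefficients, of sum zero, for all `n` and `ε`
    (∀ S : ℚ, ∃ w : Fin m → ℚ,
      ∑ i, w i = 0 ∧
      (∀ ε : ℝ, 0 < ε → ε < Real.pi / 2 → ∀ n : ℕ, 1 ≤ n → ZetaContour.IdentityS m S w ε n) ∧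
      (∀ ε : ℝ, 0 < ε → ε < Real.pi / 2 → ∀ w' : Fin m → ℚ,
        (∀ n : ℕ, 1 ≤ n → ZetaContour.IdentityS m S w' ε n) → w' = w)) ∧
    -- the coefficients solve a unit upper-triangular rational system
    (∃ A : Matrix (Fin m) (Fin m) ℚ,
      (∀ j l : Fin m, l < j → A j l = 0) ∧
      (∀ j : Fin m, A j j = 1) ∧
      (∀ j l : Fin m, (j : ℕ) = 0 → A j l = 1) ∧
      (∀ ε : ℝ, 0 < ε → ε < Real.pi / 2 → ∀ n : ℕ, 1 ≤ n → ∀ l : Fin m,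
        ZetaContour.contourIntegral ε n
            (fun z => 1 / (z * (Complex.exp z + 1) ^ ((l : ℕ) + 1))) =
          -(2 * (Real.pi : ℂ) * Complex.I) *
            ∑ k ∈ Finset.Icc 1 n, ∑ j : Fin m,
              (A j l : ℂ) / ZetaContour.pole k ^ ((j : ℕ) + 1)) ∧
      (∀ ε : ℝ, 0 < ε → ε < Real.pi / 2 → ∀ (S : ℚ) (w : Fin m → ℚ),
        (∀ n : ℕ, 1 ≤ n → ZetaContour.IdentityS m S w ε n) ↔
          A.mulVec w = ZetaContour.rhsVector m S)) ∧
    -- the special value `S = ± Γ(m)`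
    (∃ w : Fin m → ℚ,
      ∑ i, w i = 0 ∧
      (∀ ε : ℝ, 0 < ε → ε < Real.pi / 2 → ∀ n : ℕ, 1 ≤ n →
        ZetaContour.IdentityS m (ZetaContour.specialS m) w ε n ∧
        ZetaContour.IdentityGamma m w ε n) ∧
      (∀ ε : ℝ, 0 < ε → ε < Real.pi / 2 → ∀ w' : Fin m → ℚ,
        (∀ n : ℕ, 1 ≤ n → ZetaContour.IdentityGamma m w' ε n) → w' = w)) := by
  -- The linear system does not involve `ε`: one solution serves every `ε`, while the identity at a
  -- single `ε` already forces it. The case `S = specialS m` gives the last claim.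
  have hS : ∀ S : ℚ, ∃ w : Fin m → ℚ,
      ∑ i, w i = 0 ∧
      (∀ ε : ℝ, 0 < ε → ε < Real.pi / 2 → ∀ n : ℕ, 1 ≤ n → ZetaContour.IdentityS m S w ε n) ∧
      (∀ ε : ℝ, 0 < ε → ε < Real.pi / 2 → ∀ w' : Fin m → ℚ,
        (∀ n : ℕ, 1 ≤ n → ZetaContour.IdentityS m S w' ε n) → w' = w) := by
    intro S
    obtain ⟨w, hw, huniq⟩ :=
      ZetaContour.existsUnique_expansionMatrix_mulVec m (ZetaContour.rhsVector m S)
    exact ⟨w, ZetaContour.sum_eq_zero_of_mulVec_eq hm hw,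
      fun ε h0 h1 => (ZetaContour.identityS_iff hm h0 h1 S w).2 hw,
      fun ε h0 h1 w' hw' => huniq w' ((ZetaContour.identityS_iff hm h0 h1 S w').1 hw')⟩
  refine ⟨hS, ⟨ZetaContour.expansionMatrix m,
    fun j l h => ZetaContour.expansionMatrix_apply_eq_zero h,
    ZetaContour.expansionMatrix_apply_self,
    fun j l h => ZetaContour.expansionMatrix_apply_zero h l,
    fun ε h0 h1 n hn l => ZetaContour.contourIntegral_eq h0 h1 hn l,
    fun ε h0 h1 S w => ZetaContour.identityS_iff hm h0 h1 S w⟩, ?_⟩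
  obtain ⟨w, hsum, hw, huniq⟩ := hS (ZetaContour.specialS m)
  exact ⟨w, hsum, fun ε h0 h1 n hn => ⟨hw ε h0 h1 n hn,
      (ZetaContour.identityS_specialS_iff hm w ε n).1 (hw ε h0 h1 n hn)⟩,
    fun ε h0 h1 w' hw' => huniq ε h0 h1 w' fun n hn =>
      (ZetaContour.identityS_specialS_iff hm w' ε n).2 (hw' n hn)⟩
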